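/- Let $\mathcal{S}_n$ be the space of $n\times n$ real symmetric matrices. A matrix $A\in\mathcal{S}_n$ is called austere if its nonzero eigenvalues, counted with multiplicity, occur in oppositely signed pairs; a linear subspace $\mathcal{Q}\subset M(n,\mathbb{R})$ is called austere if it consists of austere (in particular symmetric) matrices. Let $S(n,\mathbb{R})$ be the unit sphere, with respect to the Frobenius norm, in the space of traceless matrices of $\mathcal{S}_n$. With $q=\lfloor (n-1)/2\rfloor$, let $$\Phi_n: S(n,\mathbb{R})\to\mathbb{R}^{q},\qquad A\mapsto(\operatorname{tr}A^3,\operatorname{tr}A^5,\dots,\operatorname{tr}A^{2q+1}),$$ and let $\mathcal{B}_{n,\mathbb{R}}$ be the set of those $A\in\Phi_n^{-1}(0)$ that are regular points of $\Phi_n$ (the differential of $\Phi_n$ at $A$ is surjective). Let $\mathcal{Q}\subset M(n,\mathbb{R})$ be an austere subspace with $\mathcal{Q}\cap\mathcal{B}_{n,\mathbb{R}}\neq\varnothing$, and let $p\ge 0$ be an integer. Then $$\dim\mathcal{Q}\le\begin{cases}p^2+2p&\text{if }n=2p+1,\\ p^2+3p+2&\text{if }n=2p+2.\end{cases}$$ Moreover,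 for every $p\ge0$ and $n=2p+2$, equality is attained: the space $$\left\{\begin{pmatrix}m_1&m_2\\ m_2&-m_1\end{pmatrix}: m_1,m_2\in\mathcal{S}_{p+1}\right\}$$ is an austere subspace, maximal among austere subspaces of $M(n,\mathbb{R})$ with respect to inclusion, it meets $\mathcal{B}_{n,\mathbb{R}}$, and its dimension is $p^2+3p+2$. -/

import Mathlib

open scoped Manifold Matrix

noncomputable section

namespace Austere

/-- A real square matrix is austere if it is symmetric and its nonzero eigenvalues, counted with
multiplicity, occur in oppositely signed pairs. -/
def IsAustere {n : ℕ} (A : Matrix (Fin n) (Fin n) ℝ) : Prop :=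
  A.IsSymm ∧ ∀ t : ℝ, t ≠ 0 → A.charpoly.roots.count t = A.charpoly.roots.count (-t)

/-- An austere subspace is a linear subspace of `M(n, ℝ)` consisting of austere matrices. -/
def IsAustereSubspace {n : ℕ} (Q : Submodule ℝ (Matrix (Fin n) (Fin n) ℝ)) : Prop :=
  ∀ A ∈ Q, IsAustere A

/-- The space `E(n, ℝ)` of traceless symmetric real matrices. -/
def tracelessSymm (n : ℕ) : Submodule ℝ (Matrix (Fin n) (Fin n) ℝ) where
  carrier := {A | A.IsSymm ∧ A.trace = 0}
  add_mem' := fun ha hb => ⟨ha.1.add hb.1, by rw [Matrix.trace_add, ha.2, hb.2, add_zero]⟩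
  zero_mem' := ⟨Matrix.isSymm_zero, Matrix.trace_zero _ _⟩
  smul_mem' := fun c _ ha => ⟨ha.1.smul c, by rw [Matrix.trace_smul, ha.2, smul_zero]⟩

section Frobenius

attribute [local instance] Matrix.frobeniusNormedAddCommGroup Matrix.frobeniusNormedSpace

/-- The Frobenius inner product `⟨A, B⟩ = tr (Aᵀ B)`, which induces Mathlib's Frobenius norm. -/
@[reducible]
def frobeniusInner (n : ℕ) : InnerProductSpace ℝ (Matrix (Fin n) (Fin n) ℝ) where
  inner A B := (Aᵀ * B).trace
  norm_sq_eq_re_inner A := by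
    have h : (0 : ℝ) ≤ ∑ i, ∑ j, A i j ^ 2 :=
      Finset.sum_nonneg fun i _ => Finset.sum_nonneg fun j _ => sq_nonneg _
    have h2 : ‖A‖ ^ 2 = ∑ i, ∑ j, A i j ^ 2 := by
      rw [Matrix.frobenius_norm_def, ← Real.sqrt_eq_rpow]
      simp only [Real.rpow_two, Real.norm_eq_abs, sq_abs]
      exact Real.sq_sqrt h
    rw [h2, Finset.sum_comm]
    simp [Matrix.trace, Matrix.mul_apply, sq]
  conj_inner_symm A B := by
    have h : (Bᵀ * A).trace = (Aᵀ * B).trace := by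
      rw [← Matrix.trace_transpose (Bᵀ * A), Matrix.transpose_mul, Matrix.transpose_transpose]
    simpa using h
  add_left A B C := by simp [Matrix.add_mul]
  smul_left A B r := by simp

attribute [local instance] frobeniusInner

/-- `E(n, ℝ)` as a Euclidean space: the traceless symmetric matrices with the Frobenius inner
product. A type synonym, so that its topology is the one given by the Frobenius norm. -/
def E (n : ℕ) : Type := tracelessSymm n

instance (n : ℕ) : NormedAddCommGroup (E n) :=
  inferInstanceAs (NormedAddCommGroup (tracelessSymm n))

instance (n : ℕ) : InnerProductSpace ℝ (E n) :=
  inferInstanceAs (InnerProductSpace ℝ (tracelessSymm n))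

instance (n : ℕ) : FiniteDimensional ℝ (E n) :=
  inferInstanceAs (FiniteDimensional ℝ (tracelessSymm n))

/-- The inclusion of `E(n, ℝ)` in the space of matrices. -/
def E.toMatrix {n : ℕ} : E n →ₗ[ℝ] Matrix (Fin n) (Fin n) ℝ := (tracelessSymm n).subtype

end Frobenius

/-- `S(n, ℝ)`: the unit sphere of `E(n, ℝ)` for the Frobenius norm. -/
abbrev unitSphere (n : ℕ) : Set (E n) := Metric.sphere (0 : E n) 1

/-- The map `Φ : S(n, ℝ) → ℝ^p`, `A ↦ (tr A³, tr A⁵, …, tr A^(2p+1))`, with `p = ⌊(n - 1) / 2⌋`. -/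
def Phi (n : ℕ) (A : unitSphere n) : EuclideanSpace ℝ (Fin ((n - 1) / 2)) :=
  WithLp.toLp 2 fun k => ((A : E n).toMatrix ^ (2 * ((k : ℕ) + 1) + 1)).trace

lemma finrank_eq {n : ℕ} (A : unitSphere n) :
    Module.finrank ℝ (E n) = (Module.finrank ℝ (E n) - 1) + 1 := by
  have hA : (A : E n) ≠ 0 := ne_zero_of_mem_unit_sphere A
  have : Nontrivial (E n) := ⟨⟨_, _, hA⟩⟩
  have h : 0 < Module.finrank ℝ (E n) := Module.finrank_pos
  omega

/-- `A` is a regular point of `Φ`: the differential of `Φ` at `A`, as a map between the manifolds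
`S(n, ℝ)` and `ℝ^p`, is surjective. -/
def IsRegularPoint {n : ℕ} (A : unitSphere n) : Prop :=
  haveI : Fact (Module.finrank ℝ (E n) = (Module.finrank ℝ (E n) - 1) + 1) := ⟨finrank_eq A⟩
  Function.Surjective
    (mfderiv (𝓡 (Module.finrank ℝ (E n) - 1))
      𝓘(ℝ, EuclideanSpace ℝ (Fin ((n - 1) / 2))) (Phi n) A)

/-- `𝓑_{n, ℝ}`: the regular points of `Φ` in `Φ⁻¹(0)`, as a set of matrices. -/
def regularSet (n : ℕ) : Set (Matrix (Fin n) (Fin n) ℝ) :=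
  {M | ∃ A : unitSphere n, (A : E n).toMatrix = M ∧ Phi n A = 0 ∧ IsRegularPoint A}

/-- The block matrix `(m₁ m₂; m₂ -m₁)`, with rows and columns numbered by `Fin (2 * k)`. -/
def blockMatrix {k : ℕ} (m₁ m₂ : Matrix (Fin k) (Fin k) ℝ) :
    Matrix (Fin (2 * k)) (Fin (2 * k)) ℝ :=
  Matrix.reindex (finSumFinEquiv.trans (finCongr (two_mul k).symm))
    (finSumFinEquiv.trans (finCongr (two_mul k).symm)) (Matrix.fromBlocks m₁ m₂ m₂ (-m₁))

/-- The space of all matrices `(m₁ m₂; m₂ -m₁)` with `m₁`, `m₂` symmetric `k × k` matrices. -/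
def blockSubspace (k : ℕ) : Submodule ℝ (Matrix (Fin (2 * k)) (Fin (2 * k)) ℝ) where
  carrier := {A | ∃ m₁ m₂ : Matrix (Fin k) (Fin k) ℝ,
    m₁.IsSymm ∧ m₂.IsSymm ∧ A = blockMatrix m₁ m₂}
  add_mem' := by
    rintro _ _ ⟨a, b, ha, hb, rfl⟩ ⟨c, d, hc, hd, rfl⟩
    refine ⟨a + c, b + d, ha.add hc, hb.add hd, ?_⟩
    have h := Matrix.fromBlocks_add a b b (-a) c d d (-c)
    rw [← neg_add] at h
    simp only [blockMatrix, ← h]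
    rfl
  zero_mem' := by
    refine ⟨0, 0, Matrix.isSymm_zero, Matrix.isSymm_zero, ?_⟩
    simp [blockMatrix]
  smul_mem' := by
    rintro c _ ⟨a, b, ha, hb, rfl⟩
    refine ⟨c • a, c • b, ha.smul c, hb.smul c, ?_⟩
    have h := Matrix.fromBlocks_smul c a b b (-a)
    rw [smul_neg] at h
    simp only [blockMatrix, ← h]
    rfl

end Austere

end

open scoped Manifold Matrix

namespace Austere

/-! Fix a regular `A ∈ Q` and an orthonormal eigenbasis with eigenvalues `a` in decreasing order;
austerity says `a i.rev = -a i`. For `B ∈ Q` let `D` be its matrix in that basis.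

Odd power traces vanish on `Q`, so differentiating along `A + t • B` gives `tr (A ^ (2k) * B) = 0`,
and polarizing the cubic trace gives `tr (A * B²) = 0`. Regularity makes the even power sums
independent on vectors invariant under `Fin.rev`. Hence `D i i + D i.rev i.rev = 0`
(`add_rev_eq_zero`), and `a i ^ 2` determines `i` up to `Fin.rev` (`eq_or_eq_rev_of_sq_eq`).

The second identity reads `∑ (a i + a j) * D i j ^ 2 = 0`. If `D` vanishes where `i + j < n`, all
remaining coefficients are nonpositive, and off the diagonal they are negative, so `D = 0`
(`eq_zero_of_upper_left_eq_zero`). Thus `B` is determined by the entries with `i ≤ j`, `i + j < n`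
and `i < n / 2`, and counting these gives the bound. The block space attains it in even size, which
also forces maximality. -/

/-! ### Spectra of austere matrices -/

lemma exists_sorted_diagonalization {n : ℕ} {A : Matrix (Fin n) (Fin n) ℝ} (hA : A.IsSymm) :
    ∃ (V : Matrix (Fin n) (Fin n) ℝ) (a : Fin n → ℝ), Vᵀ * V = 1 ∧ V * Vᵀ = 1 ∧ Antitone a ∧
      A = V * Matrix.diagonal a * Vᵀ := by
  have hH : A.IsHermitian := by
    rw [Matrix.IsHermitian, Matrix.conjTranspose_eq_transpose_of_trivial]; exact hA
  set U : Matrix (Fin n) (Fin n) ℝ := (hH.eigenvectorUnitary : Matrix (Fin n) (Fin n) ℝ) with hU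
  set b := hH.eigenvalues with hb
  have hspec : A = U * Matrix.diagonal b * Uᵀ := by
    have h := hH.spectral_theorem
    rw [Unitary.conjStarAlgAut_apply] at h
    simpa [Matrix.star_eq_conjTranspose] using h
  have hUU : U * Uᵀ = 1 := by
    have h := Unitary.coe_mul_star_self hH.eigenvectorUnitary
    simpa [Matrix.star_eq_conjTranspose] using h
  -- `Tuple.sort` sorts increasingly; the reversal makes the order decreasing.
  let τ : Equiv.Perm (Fin n) := Fin.revPerm.trans (Tuple.sort b)
  have hV : U.submatrix id τ * (U.submatrix id τ)ᵀ = 1 := by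
    rw [Matrix.transpose_submatrix, Matrix.submatrix_mul_equiv, hUU]; simp
  refine ⟨U.submatrix id τ, b ∘ τ, mul_eq_one_comm.mp hV, hV, ?_, ?_⟩
  · intro i j hij
    exact Tuple.monotone_sort b (Fin.rev_le_rev.mpr hij)
  · have h : Matrix.diagonal (b ∘ τ) = (Matrix.diagonal b).submatrix τ τ := by
      rw [Matrix.submatrix_diagonal_equiv]
    rw [h, Matrix.transpose_submatrix, Matrix.submatrix_mul_equiv, Matrix.submatrix_mul_equiv,
      ← hspec]
    simp

lemma charpoly_conj {ι : Type*} [Fintype ι] [DecidableEq ι] {V W : Matrix ι ι ℝ}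
    (hV : V * W = 1) (A : Matrix ι ι ℝ) : (V * A * W).charpoly = A.charpoly := by
  rw [Matrix.charpoly_mul_comm, ← Matrix.mul_assoc, mul_eq_one_comm.mp hV, Matrix.one_mul]

lemma roots_charpoly_diagonal {n : ℕ} (a : Fin n → ℝ) :
    (Matrix.diagonal a).charpoly.roots = Finset.univ.val.map a := by
  have h := Multiset.map_map (fun x : ℝ => Polynomial.X - Polynomial.C x) a Finset.univ.val
  rw [Function.comp_def] at h
  rw [Matrix.charpoly_diagonal, Finset.prod_eq_multiset_prod, ← h,
    Polynomial.roots_multiset_prod_X_sub_C]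

lemma count_map_neg {n : ℕ} (a : Fin n → ℝ) (t : ℝ) :
    (Finset.univ.val.map fun i => -a i).count t = (Finset.univ.val.map a).count (-t) := by
  rw [Multiset.count_map, Multiset.count_map]
  simp only [eq_neg_iff_add_eq_zero, neg_eq_iff_add_eq_zero]

/-- Both `a` and `i ↦ -a i.rev` are decreasing and enumerate the same multiset, hence coincide. -/
lemma IsAustere.rev_eigenvalue {n : ℕ} {V : Matrix (Fin n) (Fin n) ℝ} {a : Fin n → ℝ}
    (hV : V * Vᵀ = 1) (ha : Antitone a) (hA : IsAustere (V * Matrix.diagonal a * Vᵀ))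
    (i : Fin n) : a i.rev = -a i := by
  have h2 := hA.2
  rw [charpoly_conj hV, roots_charpoly_diagonal] at h2
  have hm : Finset.univ.val.map a = Finset.univ.val.map fun i : Fin n => -a i.rev := by
    have hrev : (Finset.univ.val.map fun i : Fin n => -a i.rev) =
        Finset.univ.val.map fun i => -a i := by
      have h := Multiset.map_univ_val_equiv (Fin.revPerm (n := n))
      conv_rhs => rw [← h, Multiset.map_map]
      rfl
    ext t
    rw [hrev, count_map_neg]
    rcases eq_or_ne t 0 with rfl | ht
    · simp
    · exact h2 t ht
  rw [Fin.univ_val_map, Fin.univ_val_map, Multiset.coe_eq_coe] at hm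
  have hl := List.Perm.eq_of_sortedGE (List.sortedGE_ofFn_iff.mpr ha)
    (List.sortedGE_ofFn_iff.mpr fun i j hij => neg_le_neg (ha (Fin.rev_le_rev.mpr hij))) hm
  have := congrFun (List.ofFn_injective hl) i
  linarith

lemma isAustere_of_charpoly_neg {n : ℕ} {A : Matrix (Fin n) (Fin n) ℝ} (hA : A.IsSymm)
    (h : (-A).charpoly = A.charpoly) : IsAustere A := by
  refine ⟨hA, fun t _ => ?_⟩
  obtain ⟨V, a, -, hV, -, rfl⟩ := exists_sorted_diagonalization hA
  have hneg : -(V * Matrix.diagonal a * Vᵀ) = V * Matrix.diagonal (fun i => -a i) * Vᵀ := by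
    have h : (Matrix.diagonal fun i => -a i) = -Matrix.diagonal a := (Matrix.diagonal_neg a).symm
    rw [h, Matrix.mul_neg, Matrix.neg_mul]
  rw [hneg, charpoly_conj hV, charpoly_conj hV] at h
  rw [charpoly_conj hV]
  conv_lhs => rw [← h]
  rw [roots_charpoly_diagonal, roots_charpoly_diagonal, count_map_neg]

lemma conj_pow {n : ℕ} {V : Matrix (Fin n) (Fin n) ℝ} (hV : Vᵀ * V = 1)
    (hV' : V * Vᵀ = 1) (A : Matrix (Fin n) (Fin n) ℝ) (m : ℕ) :
    (V * A * Vᵀ) ^ m = V * A ^ m * Vᵀ := by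
  induction m with
  | zero => simp [hV']
  | succ m ih =>
    rw [pow_succ, ih, pow_succ]
    simp only [Matrix.mul_assoc]
    rw [← Matrix.mul_assoc Vᵀ V, hV, Matrix.one_mul]

lemma trace_conj_pow_mul {n : ℕ} {V : Matrix (Fin n) (Fin n) ℝ} (hV : Vᵀ * V = 1)
    (hV' : V * Vᵀ = 1) (a : Fin n → ℝ) (m : ℕ) (B : Matrix (Fin n) (Fin n) ℝ) :
    ((V * Matrix.diagonal a * Vᵀ) ^ m * B).trace = ∑ i, a i ^ m * (Vᵀ * B * V) i i := by
  rw [conj_pow hV hV', Matrix.diagonal_pow, Matrix.mul_assoc, Matrix.mul_assoc,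
    Matrix.trace_mul_comm, Matrix.mul_assoc]
  simp [Matrix.trace, Matrix.diagonal_mul]

lemma IsAustere.trace_pow_odd {n : ℕ} {A : Matrix (Fin n) (Fin n) ℝ} (hA : IsAustere A) (k : ℕ) :
    (A ^ (2 * k + 1)).trace = 0 := by
  obtain ⟨V, a, hV, hV', ha, rfl⟩ := exists_sorted_diagonalization hA.1
  have h := trace_conj_pow_mul hV hV' a (2 * k + 1) 1
  rw [Matrix.mul_one, Matrix.mul_one, hV] at h
  simp only [Matrix.one_apply_eq, mul_one] at h
  rw [h]
  have h2 : ∑ i, a i ^ (2 * k + 1) = ∑ i : Fin n, a i.rev ^ (2 * k + 1) :=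
    (Equiv.sum_comp Fin.revPerm fun i : Fin n => a i ^ (2 * k + 1)).symm
  simp only [hA.rev_eigenvalue hV' ha, Odd.neg_pow ⟨k, rfl⟩, Finset.sum_neg_distrib] at h2
  linarith

/-! ### Trace identities on austere subspaces -/

section Derivative

attribute [local instance] Matrix.frobeniusNormedRing Matrix.frobeniusNormedAlgebra

/-- Cyclicity of the trace makes the `m` terms of the noncommutative Leibniz rule equal. The linear
map `L` covers both lines of matrices and the space `E n`. -/
lemma hasFDerivAt_trace_pow {n : ℕ} {F : Type*} [NormedAddCommGroup F] [NormedSpace ℝ F]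
    (L : F →L[ℝ] Matrix (Fin n) (Fin n) ℝ) (m : ℕ) (x : F) {f' : F →L[ℝ] ℝ}
    (hf' : ∀ y, f' y = m * (L x ^ (m - 1) * L y).trace) :
    HasFDerivAt (fun y => ((L y) ^ m).trace) f' x := by
  have h := (LinearMap.toContinuousLinearMap (Matrix.traceLinearMap (Fin n) ℝ ℝ)).hasFDerivAt.comp x
    (HasFDerivAt.pow' L.hasFDerivAt m)
  refine h.congr_fderiv ?_
  ext y
  have key : ∀ i ∈ Finset.range m,
      (L x ^ (m - 1 - i) * L y * L x ^ i).trace = (L x ^ (m - 1) * L y).trace := by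
    intro i hi
    rw [Finset.mem_range] at hi
    rw [Matrix.trace_mul_comm, ← Matrix.mul_assoc, ← pow_add,
      show i + (m - 1 - i) = m - 1 by omega]
  change Matrix.traceLinearMap (Fin n) ℝ ℝ ((∑ i ∈ Finset.range m,
    MulOpposite.op (L x ^ i) • L x ^ (m.pred - i) • L) y) = _
  rw [_root_.sum_apply, map_sum, hf']
  refine (Finset.sum_congr rfl key).trans ?_
  rw [Finset.sum_const, Finset.card_range, nsmul_eq_mul]

lemma hasDerivAt_trace_pow {n : ℕ} (A B : Matrix (Fin n) (Fin n) ℝ) (m : ℕ) :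
    HasDerivAt (fun t : ℝ => ((A + t • B) ^ m).trace) (m * (A ^ (m - 1) * B).trace) 0 := by
  have h := hasFDerivAt_trace_pow (ContinuousLinearMap.id ℝ (Matrix (Fin n) (Fin n) ℝ)) m
    (A + (0 : ℝ) • B) (f' := LinearMap.toContinuousLinearMap
      ((m : ℝ) • Matrix.traceLinearMap (Fin n) ℝ ℝ ∘ₗ
        LinearMap.mulLeft ℝ ((A + (0 : ℝ) • B) ^ (m - 1)))) fun y => rfl
  have h1 : HasDerivAt (fun t : ℝ => A + t • B) ((1 : ℝ) • B) 0 :=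
    ((hasDerivAt_id (0 : ℝ)).smul_const B).const_add A
  have h2 := h.comp_hasDerivAt (0 : ℝ) h1
  refine h2.congr_deriv ?_
  change (m : ℝ) * ((A + (0 : ℝ) • B) ^ (m - 1) * ((1 : ℝ) • B)).trace = _
  rw [zero_smul, add_zero, one_smul]

end Derivative

lemma IsAustereSubspace.trace_pow_mul {n : ℕ} {Q : Submodule ℝ (Matrix (Fin n) (Fin n) ℝ)}
    (hQ : IsAustereSubspace Q) {A B : Matrix (Fin n) (Fin n) ℝ} (hA : A ∈ Q) (hB : B ∈ Q) (k : ℕ) :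
    (A ^ (2 * k) * B).trace = 0 := by
  have h := hasDerivAt_trace_pow A B (2 * k + 1)
  have h0 : (fun t : ℝ => ((A + t • B) ^ (2 * k + 1)).trace) = fun _ => 0 := by
    funext t
    exact (hQ _ (Q.add_mem hA (Q.smul_mem t hB))).trace_pow_odd k
  rw [h0] at h
  have h1 := h.unique (hasDerivAt_const (0 : ℝ) (0 : ℝ))
  rw [Nat.add_sub_cancel] at h1
  exact (mul_eq_zero.mp h1).resolve_left (by positivity)

/-- Expand `tr ((A + B)² * B) = 0`: the terms in `A² * B` and `B³` vanish, and the two mixed terms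
have equal trace. -/
lemma IsAustereSubspace.trace_mul_sq {n : ℕ} {Q : Submodule ℝ (Matrix (Fin n) (Fin n) ℝ)}
    (hQ : IsAustereSubspace Q) {A B : Matrix (Fin n) (Fin n) ℝ} (hA : A ∈ Q) (hB : B ∈ Q) :
    (A * (B * B)).trace = 0 := by
  have h := hQ.trace_pow_mul (Q.add_mem hA hB) hB 1
  have h1 := hQ.trace_pow_mul hA hB 1
  have h2 := hQ.trace_pow_mul hB hB 1
  have e : (A + B) ^ (2 * 1) * B = A ^ (2 * 1) * B + A * (B * B) + B * A * B + B ^ (2 * 1) * B := by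
    rw [mul_one]; noncomm_ring
  have h3 : (B * A * B).trace = (A * (B * B)).trace := by
    rw [Matrix.mul_assoc, Matrix.trace_mul_comm, Matrix.mul_assoc]
  rw [e, Matrix.trace_add, Matrix.trace_add, Matrix.trace_add, h1, h2, h3] at h
  linarith

/-! ### Consequences of regularity and of the sign pattern -/

/-- Even moments see only the symmetrization of `d`, which lives on the `q + 1` orbits of `Fin.rev`.
The `q + 1` moments therefore form a square linear system `M`, and regularity makes it surjective,
hence injective. -/
lemma add_rev_eq_zero {n : ℕ} {a : Fin n → ℝ} (ha : ∀ i, a i.rev = -a i)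
    (hsurj : ∀ c : Fin ((n - 1) / 2) → ℝ, ∃ d : Fin n → ℝ, ∑ i, d i = 0 ∧
      ∀ k : Fin ((n - 1) / 2), ∑ i, a i ^ (2 * ((k : ℕ) + 1)) * d i = c k)
    {d : Fin n → ℝ} (hd : ∀ k : ℕ, ∑ i, a i ^ (2 * k) * d i = 0) (i : Fin n) :
    d i + d i.rev = 0 := by
  have hn : 0 < n := i.pos
  let q := (n - 1) / 2
  let half : Fin n → Fin (q + 1) := fun i => ⟨min i (n - 1 - i), by omega⟩
  let emb : Fin (q + 1) → Fin n := fun m => ⟨m, by omega⟩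
  have hemb : ∀ i, emb (half i) = i ∨ emb (half i) = i.rev := by
    intro i
    simp only [emb, half, Fin.ext_iff, Fin.val_rev]
    omega
  let sym : (Fin n → ℝ) → Fin (q + 1) → ℝ := fun d m => d (emb m) + d (emb m).rev
  have hsym : ∀ d i, sym d (half i) = d i + d i.rev := by
    intro d i
    rcases hemb i with h | h <;> simp [sym, h, add_comm]
  let M : (Fin (q + 1) → ℝ) →ₗ[ℝ] Fin (q + 1) → ℝ :=
    { toFun := fun e k => ∑ i, a i ^ (2 * (k : ℕ)) * e (half i)
      map_add' := fun e f => by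
        funext k; simp [mul_add, Finset.sum_add_distrib]
      map_smul' := fun c e => by
        funext k; simp [Finset.mul_sum, mul_left_comm] }
  have hM : ∀ d k, M (sym d) k = 2 * ∑ i, a i ^ (2 * (k : ℕ)) * d i := by
    intro d k
    have h : ∑ i, a i ^ (2 * (k : ℕ)) * d i.rev = ∑ i, a i ^ (2 * (k : ℕ)) * d i := by
      rw [← Equiv.sum_comp Fin.revPerm fun i => a i ^ (2 * (k : ℕ)) * d i]
      refine Finset.sum_congr rfl fun i _ => ?_
      simp [ha, pow_mul]
    change ∑ i, a i ^ (2 * (k : ℕ)) * sym d (half i) = _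
    simp only [hsym, mul_add, Finset.sum_add_distrib]
    rw [h]; ring
  have hMsurj : Function.Surjective M := by
    intro c
    let z : Fin n := ⟨0, hn⟩
    -- A spike of height `c 0 / 2` at `z` supplies the zeroth moment, which `d` cannot; its higher
    -- moments are subtracted in advance. The halves offset the factor 2 in `hM`.
    obtain ⟨d, hd0, hd⟩ := hsurj fun k : Fin q => c k.succ / 2 - a z ^ (2 * ((k : ℕ) + 1)) * (c 0 / 2)
    refine ⟨sym (d + Pi.single z (c 0 / 2)), ?_⟩
    funext k
    rw [hM]
    refine Fin.cases ?_ (fun k => ?_) k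
    · simp [Finset.sum_add_distrib, hd0]; ring
    · simp only [Pi.add_apply, mul_add (a _ ^ _), Finset.sum_add_distrib, Fin.val_succ]
      rw [hd k]
      simp [Pi.single_apply]
      ring
  have hMinj : Function.Injective M := LinearMap.injective_iff_surjective.mpr hMsurj
  have h0 : sym d = 0 := hMinj (by
    rw [map_zero]; funext k; rw [hM, hd]; simp)
  rw [← hsym, h0]; rfl

/-- Otherwise the difference of the unit vectors at `i` and `j` has zero even moments but a nonzero
symmetrization. -/
lemma eq_or_eq_rev_of_sq_eq {n : ℕ} {a : Fin n → ℝ} (ha : ∀ i, a i.rev = -a i)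
    (hsurj : ∀ c : Fin ((n - 1) / 2) → ℝ, ∃ d : Fin n → ℝ, ∑ i, d i = 0 ∧
      ∀ k : Fin ((n - 1) / 2), ∑ i, a i ^ (2 * ((k : ℕ) + 1)) * d i = c k)
    {i j : Fin n} (hij : a i ^ 2 = a j ^ 2) : j = i ∨ j = i.rev := by
  by_contra! hne
  have h := add_rev_eq_zero ha hsurj (d := Pi.single i 1 - Pi.single j 1) (fun k => by
    simp [mul_sub, Finset.sum_sub_distrib, Pi.single_apply, pow_mul, hij]) i
  simp only [Pi.sub_apply, Pi.single_eq_same, Pi.single_apply, if_neg hne.1.symm,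
    if_neg hne.2.symm] at h
  split_ifs at h <;> norm_num at h

lemma eq_zero_of_upper_left_eq_zero {n : ℕ} {a : Fin n → ℝ} (ha : Antitone a)
    (harev : ∀ i, a i.rev = -a i) (hsq : ∀ i j, a i ^ 2 = a j ^ 2 → j = i ∨ j = i.rev)
    {D : Matrix (Fin n) (Fin n) ℝ} (hD : D.IsSymm) (hdiag : ∀ i, D i i + D i.rev i.rev = 0)
    (hquad : ∑ i, a i * (D * D) i i = 0)
    (hzero : ∀ i j : Fin n, i ≤ j → (i : ℕ) + j < n → 2 * (i : ℕ) + 1 < n → D i j = 0) :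
    D = 0 := by
  have hd : ∀ i, D i i = 0 := by
    intro i
    have h := hdiag i
    rcases lt_trichotomy i i.rev with hi | hi | hi
    · rw [Fin.lt_def, Fin.val_rev] at hi
      exact hzero i i le_rfl (by omega) (by omega)
    · rw [← hi] at h; linarith
    · rw [Fin.lt_def, Fin.val_rev] at hi
      rwa [hzero i.rev i.rev le_rfl (by rw [Fin.val_rev]; omega) (by rw [Fin.val_rev]; omega),
        add_zero] at h
  have hup : ∀ i j : Fin n, (i : ℕ) + j < n → D i j = 0 := by
    intro i j hij
    rcases lt_trichotomy i j with h | rfl | h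
    · exact hzero i j h.le hij (by rw [Fin.lt_def] at h; omega)
    · exact hd i
    · rw [← hD.apply i j]
      exact hzero j i h.le (by omega) (by rw [Fin.lt_def] at h; omega)
  have hsign : ∀ i j : Fin n, n ≤ (i : ℕ) + j → a i + a j ≤ 0 := by
    intro i j hij
    have h := ha (show j.rev ≤ i by rw [Fin.le_def, Fin.val_rev]; omega)
    rw [harev] at h; linarith
  have hterm : ∀ i j, (a i + a j) * D i j ^ 2 ≤ 0 := by
    intro i j
    rcases lt_or_ge ((i : ℕ) + j) n with h | h
    · simp [hup i j h]
    · exact mul_nonpos_of_nonpos_of_nonneg (hsign i j h) (sq_nonneg _)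
  have hsum : ∑ i, ∑ j, (a i + a j) * D i j ^ 2 = 0 := by
    have h1 : ∑ i, ∑ j, a i * D i j ^ 2 = 0 := by
      rw [← hquad]
      refine Finset.sum_congr rfl fun i _ => ?_
      rw [Matrix.mul_apply, Finset.mul_sum]
      refine Finset.sum_congr rfl fun j _ => ?_
      rw [hD.apply i j, sq]
    have h2 : ∑ i, ∑ j, a j * D i j ^ 2 = 0 := by
      rw [Finset.sum_comm, ← h1]
      refine Finset.sum_congr rfl fun i _ => Finset.sum_congr rfl fun j _ => ?_
      rw [hD.apply i j]
    simp only [add_mul, Finset.sum_add_distrib, h1, h2, add_zero]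
  ext i j
  rw [Matrix.zero_apply]
  rcases lt_or_ge ((i : ℕ) + j) n with h | h
  · exact hup i j h
  by_contra hne
  have h1 := (Finset.sum_eq_zero_iff_of_nonpos fun i _ =>
    Finset.sum_nonpos fun j _ => hterm i j).mp hsum i (Finset.mem_univ i)
  have h2 := (Finset.sum_eq_zero_iff_of_nonpos fun j _ => hterm i j).mp h1 j (Finset.mem_univ j)
  -- The case `j = i` is excluded by the zero diagonal; `j = i.rev` has `i + j = n - 1`, inside the
  -- vanishing triangle.
  have h3 : a i + a j = 0 := (mul_eq_zero.mp h2).resolve_right (pow_ne_zero 2 hne)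
  rcases hsq i j (by rw [eq_neg_of_add_eq_zero_left h3, neg_sq]) with rfl | rfl
  · exact hne (hd _)
  · rw [Fin.val_rev] at h; omega

lemma sum_odd_rows (p : ℕ) : ∑ i ∈ Finset.range p, (2 * p + 1 - 2 * i) = p ^ 2 + 2 * p := by
  induction p with
  | zero => rfl
  | succ p ih =>
    -- Peeling off the first, longest row leaves the triangle for `p`.
    rw [Finset.sum_range_succ']
    have h : ∀ i ∈ Finset.range p, 2 * (p + 1) + 1 - 2 * (i + 1) = 2 * p + 1 - 2 * i := by
      intro i _; omega
    rw [Finset.sum_congr rfl h, ih, Nat.mul_zero, Nat.sub_zero]; ring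

lemma sum_even_rows (p : ℕ) : ∑ i ∈ Finset.range p, (2 * p - 2 * i) = p ^ 2 + p := by
  induction p with
  | zero => rfl
  | succ p ih =>
    rw [Finset.sum_range_succ']
    have h : ∀ i ∈ Finset.range p, 2 * (p + 1) - 2 * (i + 1) = 2 * p - 2 * i := by
      intro i _; omega
    rw [Finset.sum_congr rfl h, ih, Nat.mul_zero, Nat.sub_zero]; ring

/-! ### Regular points in terms of traces -/

section Regular

attribute [local instance] Matrix.frobeniusNormedRing Matrix.frobeniusNormedAlgebra

/-- The differential at `A` of the extension of `Phi` to `E n`. -/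
noncomputable def phiDeriv {n : ℕ} (A : E n) : E n →L[ℝ] EuclideanSpace ℝ (Fin ((n - 1) / 2)) :=
  LinearMap.toContinuousLinearMap ((WithLp.linearEquiv 2 ℝ _).symm.toLinearMap ∘ₗ
    LinearMap.pi fun k : Fin ((n - 1) / 2) => ((2 * ((k : ℕ) + 1) + 1 : ℕ) : ℝ) •
      (Matrix.traceLinearMap (Fin n) ℝ ℝ ∘ₗ
        LinearMap.mulLeft ℝ (A.toMatrix ^ (2 * ((k : ℕ) + 1))) ∘ₗ E.toMatrix))

lemma phiDeriv_apply {n : ℕ} (A B : E n) (k : Fin ((n - 1) / 2)) :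
    phiDeriv A B k = ((2 * ((k : ℕ) + 1) + 1 : ℕ) : ℝ) *
      (A.toMatrix ^ (2 * ((k : ℕ) + 1)) * B.toMatrix).trace := rfl

lemma hasFDerivAt_phiDeriv {n : ℕ} (A : E n) :
    HasFDerivAt (fun X : E n => (WithLp.toLp 2 fun k : Fin ((n - 1) / 2) =>
      (X.toMatrix ^ (2 * ((k : ℕ) + 1) + 1)).trace : EuclideanSpace ℝ (Fin ((n - 1) / 2))))
      (phiDeriv A) A := by
  rw [← hasFDerivWithinAt_univ, hasFDerivWithinAt_euclidean]
  intro k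
  rw [hasFDerivWithinAt_univ]
  exact hasFDerivAt_trace_pow (LinearMap.toContinuousLinearMap (E.toMatrix (n := n)))
    (2 * ((k : ℕ) + 1) + 1) A fun y => rfl

/-- The tangent space of the sphere at `A` is the orthogonal complement of `A`, whence the condition
`tr (A * B) = 0`; the nonzero factors `2k + 3` of the differential do not affect surjectivity. -/
lemma isRegularPoint_iff {n : ℕ} (A : unitSphere n) :
    IsRegularPoint A ↔ ∀ c : Fin ((n - 1) / 2) → ℝ, ∃ B : E n,
      ((A : E n).toMatrix * B.toMatrix).trace = 0 ∧
        ∀ k : Fin ((n - 1) / 2),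
          ((A : E n).toMatrix ^ (2 * ((k : ℕ) + 1)) * B.toMatrix).trace = c k := by
  have : Fact (Module.finrank ℝ (E n) = (Module.finrank ℝ (E n) - 1) + 1) := ⟨finrank_eq A⟩
  have hcoe : MDifferentiableAt (𝓡 (Module.finrank ℝ (E n) - 1)) 𝓘(ℝ, E n)
      (Subtype.val : unitSphere n → E n) A :=
    (contMDiff_coe_sphere A).mdifferentiableAt one_ne_zero
  have hrange := range_mvfderiv_subtypeVal (n := Module.finrank ℝ (E n) - 1) A
  have horth : ∀ B : E n, B ∈ (ℝ ∙ (A : E n))ᗮ ↔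
      ((A : E n).toMatrix * B.toMatrix).trace = 0 := by
    intro B
    rw [Submodule.mem_orthogonal_singleton_iff_inner_right]
    have hs : ((A : E n).toMatrix)ᵀ = (A : E n).toMatrix := (A : E n).2.1
    change (((A : E n).toMatrix)ᵀ * B.toMatrix).trace = 0 ↔ _
    rw [hs]
  have hder : mfderiv (𝓡 (Module.finrank ℝ (E n) - 1))
      𝓘(ℝ, EuclideanSpace ℝ (Fin ((n - 1) / 2))) (Phi n) A =
      (phiDeriv (A : E n)).comp (mfderiv (𝓡 (Module.finrank ℝ (E n) - 1)) 𝓘(ℝ, E n)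
        (Subtype.val : unitSphere n → E n) A) :=
    ((hasFDerivAt_phiDeriv (A : E n)).hasMFDerivAt.comp A hcoe.hasMFDerivAt).mfderiv
  have hpos : ∀ k : Fin ((n - 1) / 2), ((2 * ((k : ℕ) + 1) + 1 : ℕ) : ℝ) ≠ 0 := fun k => by
    positivity
  unfold IsRegularPoint
  rw [hder]
  -- `D` is the differential of the inclusion, typed between vector spaces instead of tangent
  -- spaces.
  obtain ⟨D, hD⟩ : ∃ D : EuclideanSpace ℝ (Fin (Module.finrank ℝ (E n) - 1)) →L[ℝ] E n,
      D = mfderiv (𝓡 (Module.finrank ℝ (E n) - 1)) 𝓘(ℝ, E n)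
        (Subtype.val : unitSphere n → E n) A := ⟨_, rfl⟩
  have hrangeD : ∀ B : E n, (∃ v, D v = B) ↔ ((A : E n).toMatrix * B.toMatrix).trace = 0 := by
    intro B
    rw [← horth, ← hrange, hD]
    exact LinearMap.mem_range.symm
  rw [← hD]
  change Function.Surjective ((phiDeriv (A : E n)).comp D) ↔ _
  constructor
  · intro h c
    obtain ⟨v, hv⟩ := h (WithLp.toLp 2 fun k : Fin ((n - 1) / 2) =>
      ((2 * ((k : ℕ) + 1) + 1 : ℕ) : ℝ) * c k)
    refine ⟨D v, (hrangeD _).mp ⟨v, rfl⟩, fun k => ?_⟩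
    have hk := congrArg (fun w : EuclideanSpace ℝ (Fin ((n - 1) / 2)) => w k) hv
    exact mul_left_cancel₀ (hpos k) hk
  · intro h c
    obtain ⟨B, hB, hBc⟩ := h fun k => c k / ((2 * ((k : ℕ) + 1) + 1 : ℕ) : ℝ)
    obtain ⟨v, rfl⟩ := (hrangeD B).mpr hB
    refine ⟨v, ?_⟩
    ext k
    change phiDeriv (A : E n) (D v) k = _
    rw [phiDeriv_apply, hBc, mul_div_cancel₀ _ (hpos k)]

lemma norm_eq_one_iff {n : ℕ} (A : E n) :
    ‖A‖ = 1 ↔ (A.toMatrix * A.toMatrix).trace = 1 := by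
  have hs : (A.toMatrix)ᵀ = A.toMatrix := A.2.1
  have h : ‖A‖ ^ 2 = ((A.toMatrix)ᵀ * A.toMatrix).trace := (real_inner_self_eq_norm_sq A).symm
  rw [hs] at h
  rw [← h, pow_eq_one_iff_of_nonneg (norm_nonneg A) two_ne_zero]

end Regular

/-! ### The dimension bound -/

lemma IsAustereSubspace.finrank_le_sum {n : ℕ} {Q : Submodule ℝ (Matrix (Fin n) (Fin n) ℝ)}
    (hQ : IsAustereSubspace Q)
    (hreg : ((Q : Set (Matrix (Fin n) (Fin n) ℝ)) ∩ regularSet n).Nonempty) :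
    Module.finrank ℝ Q ≤ ∑ i ∈ Finset.range (n / 2), (n - 2 * i) := by
  obtain ⟨_, hAQ, A, rfl, -, hA⟩ := hreg
  rw [isRegularPoint_iff] at hA
  obtain ⟨V, a, hV, hV', ha, hAV⟩ := exists_sorted_diagonalization (A : E n).2.1
  change (A : E n).toMatrix = _ at hAV
  rw [hAV] at hA hAQ
  have harev := (hQ _ hAQ).rev_eigenvalue hV' ha
  have htr : ∀ B : Matrix (Fin n) (Fin n) ℝ, ∑ i, (Vᵀ * B * V) i i = B.trace := by
    intro B
    have h := trace_conj_pow_mul hV hV' a 0 B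
    simpa using h.symm
  have hsurj : ∀ c : Fin ((n - 1) / 2) → ℝ, ∃ d : Fin n → ℝ, ∑ i, d i = 0 ∧
      ∀ k : Fin ((n - 1) / 2), ∑ i, a i ^ (2 * ((k : ℕ) + 1)) * d i = c k := by
    intro c
    obtain ⟨B, -, hB⟩ := hA c
    refine ⟨fun i => (Vᵀ * B.toMatrix * V) i i, ?_, fun k => ?_⟩
    · rw [htr]; exact B.2.2
    · rw [← trace_conj_pow_mul hV hV', hB]
  -- Row `i` contributes the columns from `i` to `n - 1 - i`. For odd `n` the central diagonal entry
  -- is omitted, being zero already.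
  let T : Q →ₗ[ℝ] (Σ i : Fin (n / 2), Fin (n - 2 * i)) → ℝ :=
    { toFun := fun B s => (Vᵀ * (B : Matrix (Fin n) (Fin n) ℝ) * V)
        ⟨s.1, by omega⟩ ⟨s.1 + s.2, by omega⟩
      map_add' := fun B C => by
        funext s; simp [Matrix.mul_add, Matrix.add_mul]
      map_smul' := fun c B => by
        funext s; simp }
  have hT : Function.Injective T := by
    rw [injective_iff_map_eq_zero]
    rintro ⟨B, hB⟩ h0
    have hDsymm : (Vᵀ * B * V).IsSymm := by
      rw [Matrix.IsSymm, Matrix.transpose_mul, Matrix.transpose_mul, Matrix.transpose_transpose,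
        (hQ B hB).1, Matrix.mul_assoc]
    have hD : Vᵀ * B * V = 0 := by
      refine eq_zero_of_upper_left_eq_zero ha harev
        (fun i j => eq_or_eq_rev_of_sq_eq harev hsurj) hDsymm
        (add_rev_eq_zero harev hsurj (d := fun i => (Vᵀ * B * V) i i) fun k => ?_) ?_ ?_
      · rw [← trace_conj_pow_mul hV hV']
        exact hQ.trace_pow_mul hAQ hB k
      · have h := trace_conj_pow_mul hV hV' a 1 (B * B)
        rw [pow_one, hQ.trace_mul_sq hAQ hB] at h
        rw [h]
        refine Finset.sum_congr rfl fun i _ => ?_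
        have e : Vᵀ * B * V * (Vᵀ * B * V) = Vᵀ * (B * B) * V := by
          calc Vᵀ * B * V * (Vᵀ * B * V) = Vᵀ * B * (V * Vᵀ) * B * V := by
                simp only [Matrix.mul_assoc]
            _ = Vᵀ * (B * B) * V := by rw [hV', Matrix.mul_one, Matrix.mul_assoc Vᵀ]
        rw [pow_one, e]
      · intro i j hij hlt hi
        rw [Fin.le_def] at hij
        have h := congrFun h0 ⟨⟨i, by omega⟩, ⟨j - i, by simp only; omega⟩⟩
        have hj : (⟨(i : ℕ) + (j - i), by omega⟩ : Fin n) = j := by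
          ext; simp only; omega
        simpa [T, hj] using h
    have hB0 : B = V * (Vᵀ * B * V) * Vᵀ := by
      calc B = (V * Vᵀ) * B * (V * Vᵀ) := by rw [hV', Matrix.one_mul, Matrix.mul_one]
        _ = _ := by simp only [Matrix.mul_assoc]
    rw [hD, Matrix.mul_zero, Matrix.zero_mul] at hB0
    exact Subtype.ext hB0
  have h := LinearMap.finrank_le_finrank_of_injective hT
  rw [Module.finrank_fintype_fun_eq_card, Fintype.card_sigma] at h
  simp only [Fintype.card_fin] at h
  rwa [Fin.sum_univ_eq_sum_range (fun i => n - 2 * i) (n / 2)] at h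

lemma IsAustereSubspace.finrank_le_of_odd {p : ℕ}
    {Q : Submodule ℝ (Matrix (Fin (2 * p + 1)) (Fin (2 * p + 1)) ℝ)} (hQ : IsAustereSubspace Q)
    (hreg : ((Q : Set (Matrix (Fin (2 * p + 1)) (Fin (2 * p + 1)) ℝ)) ∩
      regularSet (2 * p + 1)).Nonempty) :
    Module.finrank ℝ Q ≤ p ^ 2 + 2 * p := by
  have h := hQ.finrank_le_sum hreg
  rwa [show (2 * p + 1) / 2 = p by omega, sum_odd_rows] at h

lemma IsAustereSubspace.finrank_le_of_even {p : ℕ}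
    {Q : Submodule ℝ (Matrix (Fin (2 * (p + 1))) (Fin (2 * (p + 1))) ℝ)} (hQ : IsAustereSubspace Q)
    (hreg : ((Q : Set (Matrix (Fin (2 * (p + 1))) (Fin (2 * (p + 1))) ℝ)) ∩
      regularSet (2 * (p + 1))).Nonempty) :
    Module.finrank ℝ Q ≤ p ^ 2 + 3 * p + 2 := by
  have h := hQ.finrank_le_sum hreg
  rw [show 2 * (p + 1) / 2 = p + 1 by omega, sum_even_rows] at h
  linarith

/-! ### Equality in even dimension -/

lemma isAustereSubspace_blockSubspace (k : ℕ) : IsAustereSubspace (blockSubspace k) := by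
  rintro _ ⟨m₁, m₂, h₁, h₂, rfl⟩
  refine isAustere_of_charpoly_neg ?_ ?_
  · exact (Matrix.IsSymm.fromBlocks h₁ h₂ h₁.neg).submatrix _
  -- The quarter turn `(0 1; -1 0)` conjugates the block matrix to its negative.
  · have hJ : Matrix.fromBlocks (0 : Matrix (Fin k) (Fin k) ℝ) (1 : Matrix (Fin k) (Fin k) ℝ)
        (-1 : Matrix (Fin k) (Fin k) ℝ) (0 : Matrix (Fin k) (Fin k) ℝ) *
        Matrix.fromBlocks 0 (-1) 1 0 = 1 := by
      rw [Matrix.fromBlocks_multiply, ← Matrix.fromBlocks_one]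
      simp
    have hneg : -Matrix.fromBlocks m₁ m₂ m₂ (-m₁) = Matrix.fromBlocks 0 1 (-1) 0 *
        Matrix.fromBlocks m₁ m₂ m₂ (-m₁) * Matrix.fromBlocks 0 (-1) 1 0 := by
      rw [Matrix.fromBlocks_neg, Matrix.fromBlocks_multiply, Matrix.fromBlocks_multiply]
      simp
    have hblock : -blockMatrix m₁ m₂ = Matrix.reindex
        (finSumFinEquiv.trans (finCongr (two_mul k).symm))
        (finSumFinEquiv.trans (finCongr (two_mul k).symm))
        (-Matrix.fromBlocks m₁ m₂ m₂ (-m₁)) := rfl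
    rw [hblock, Matrix.charpoly_reindex, hneg, charpoly_conj hJ, blockMatrix,
      Matrix.charpoly_reindex]

/-- The diagonal matrix with diagonal entries `u`, followed by `v`. -/
noncomputable def doubleDiagonal {k : ℕ} (u v : Fin k → ℝ) :
    Matrix (Fin (2 * k)) (Fin (2 * k)) ℝ :=
  Matrix.diagonal (Sum.elim u v ∘ (finSumFinEquiv.trans (finCongr (two_mul k).symm)).symm)

lemma trace_doubleDiagonal {k : ℕ} (u v : Fin k → ℝ) :
    (doubleDiagonal u v).trace = ∑ i, u i + ∑ i, v i := by
  rw [doubleDiagonal, Matrix.trace_diagonal]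
  simp only [Function.comp_apply]
  rw [Equiv.sum_comp (finSumFinEquiv.trans (finCongr (two_mul k).symm)).symm (Sum.elim u v),
    Fintype.sum_sum_type]
  rfl

lemma doubleDiagonal_mul {k : ℕ} (u v u' v' : Fin k → ℝ) :
    doubleDiagonal u v * doubleDiagonal u' v' = doubleDiagonal (u * u') (v * v') := by
  rw [doubleDiagonal, doubleDiagonal, Matrix.diagonal_mul_diagonal, doubleDiagonal]
  congr 1
  funext i
  simp only [Function.comp_apply]
  rcases (finSumFinEquiv.trans (finCongr (two_mul k).symm)).symm i with j | j <;> rfl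

lemma doubleDiagonal_pow {k : ℕ} (u v : Fin k → ℝ) (m : ℕ) :
    doubleDiagonal u v ^ m = doubleDiagonal (u ^ m) (v ^ m) := by
  rw [doubleDiagonal, Matrix.diagonal_pow, doubleDiagonal]
  congr 1
  funext i
  simp only [Pi.pow_apply, Function.comp_apply]
  rcases (finSumFinEquiv.trans (finCongr (two_mul k).symm)).symm i with j | j <;> rfl

lemma doubleDiagonal_neg_eq {k : ℕ} (u : Fin k → ℝ) :
    doubleDiagonal u (-u) = blockMatrix (Matrix.diagonal u) 0 := by
  have h : -Matrix.diagonal u = Matrix.diagonal (-u) := Matrix.diagonal_neg u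
  rw [blockMatrix, Matrix.reindex_apply, h, Matrix.fromBlocks_diagonal,
    Matrix.submatrix_diagonal_equiv]
  rfl

lemma exists_sum_pow_mul_eq {k : ℕ} {f : Fin k → ℝ} (hf : Function.Injective f)
    (c : Fin k → ℝ) : ∃ d : Fin k → ℝ, ∀ j : Fin k, ∑ i, d i * f i ^ (j : ℕ) = c j := by
  have hinj : Function.Injective (Matrix.vecMulLinear (Matrix.vandermonde f)) := by
    rw [injective_iff_map_eq_zero]
    intro d hd
    exact Matrix.eq_zero_of_forall_pow_sum_mul_pow_eq_zero hf (congrFun hd)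
  obtain ⟨d, hd⟩ := LinearMap.injective_iff_surjective.mp hinj c
  exact ⟨d, congrFun hd⟩

lemma exists_injective_sq_sum_eq (p : ℕ) : ∃ u : Fin (p + 1) → ℝ,
    (Function.Injective fun i => u i ^ 2) ∧ 2 * ∑ i, u i ^ 2 = 1 := by
  set S : ℝ := 2 * ∑ i : Fin (p + 1), ((i : ℝ) + 1) ^ 2
  have hS : 0 < S := mul_pos two_pos (Finset.sum_pos (fun i _ => by positivity) ⟨0, Finset.mem_univ _⟩)
  refine ⟨fun i => ((i : ℝ) + 1) / √S, fun i j hij => ?_, ?_⟩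
  · simp only [div_pow, Real.sq_sqrt hS.le] at hij
    rw [div_left_inj' hS.ne', sq_eq_sq₀ (by positivity) (by positivity)] at hij
    ext
    exact_mod_cast add_right_cancel hij
  · simp only [div_pow, Real.sq_sqrt hS.le]
    rw [← Finset.sum_div, ← mul_div_assoc]
    exact div_self hS.ne'

/-- The witness is `diag(u, -u)` with distinct `u i ^ 2`. Directions `diag(d, d)` are tangent once
`d` has sum zero, and the differential on them is a Vandermonde system in the `u i ^ 2`. -/
lemma blockSubspace_inter_regularSet_nonempty (p : ℕ) :
    ((blockSubspace (p + 1) : Set (Matrix (Fin (2 * (p + 1))) (Fin (2 * (p + 1))) ℝ)) ∩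
      regularSet (2 * (p + 1))).Nonempty := by
  obtain ⟨u, hu, hnorm⟩ := exists_injective_sq_sum_eq p
  have hmem : doubleDiagonal u (-u) ∈ blockSubspace (p + 1) :=
    ⟨Matrix.diagonal u, 0, Matrix.isSymm_diagonal u, Matrix.isSymm_zero, doubleDiagonal_neg_eq u⟩
  have haus := isAustereSubspace_blockSubspace (p + 1) _ hmem
  have htr : (doubleDiagonal u (-u)).trace = 0 := by
    rw [trace_doubleDiagonal]; simp
  let A : E (2 * (p + 1)) := ⟨doubleDiagonal u (-u), haus.1, htr⟩
  have hAm : A.toMatrix = doubleDiagonal u (-u) := rfl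
  have hA : A ∈ unitSphere (2 * (p + 1)) := by
    rw [mem_sphere_zero_iff_norm, norm_eq_one_iff, hAm, doubleDiagonal_mul, trace_doubleDiagonal,
      neg_mul_neg, ← two_mul, ← hnorm]
    simp only [Pi.mul_apply, sq]
  refine ⟨_, hmem, ⟨A, hA⟩, rfl, ?_, ?_⟩
  · ext k
    exact haus.trace_pow_odd _
  · rw [isRegularPoint_iff]
    intro c
    have hq : (2 * (p + 1) - 1) / 2 = p := by omega
    obtain ⟨d, hd⟩ := exists_sum_pow_mul_eq hu
      -- The zeroth moment is set to 0 for tracelessness; the others are halved because both blocks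
      -- contribute.
      (Fin.cases 0 fun k => c (Fin.cast hq.symm k) / 2)
    have hBtr : (doubleDiagonal d d).trace = 0 := by
      have h0 := hd 0
      rw [trace_doubleDiagonal]
      simp only [Fin.val_zero, pow_zero, mul_one, Fin.cases_zero] at h0
      rw [h0, add_zero]
    refine ⟨⟨doubleDiagonal d d, Matrix.isSymm_diagonal _, hBtr⟩, ?_, fun k => ?_⟩
    · change (doubleDiagonal u (-u) * doubleDiagonal d d).trace = 0
      rw [doubleDiagonal_mul, trace_doubleDiagonal]
      simp
    · change (doubleDiagonal u (-u) ^ _ * doubleDiagonal d d).trace = c k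
      have hk := hd (Fin.cast hq k).succ
      simp only [Fin.cases_succ, Fin.val_succ, Fin.val_cast, Fin.cast_cast, Fin.cast_eq_self] at hk
      rw [doubleDiagonal_pow, doubleDiagonal_mul, trace_doubleDiagonal, Even.neg_pow (even_two_mul _),
        ← two_mul]
      simp only [Pi.mul_apply, Pi.pow_apply, pow_mul, mul_comm _ (d _)]
      rw [hk]
      ring

/-- The symmetric matrix whose entries are given by a function on unordered pairs. -/
def symmOfSym2 {k : ℕ} (f : Sym2 (Fin k) → ℝ) : Matrix (Fin k) (Fin k) ℝ :=
  Matrix.of fun i j => f s(i, j)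

lemma isSymm_symmOfSym2 {k : ℕ} (f : Sym2 (Fin k) → ℝ) : (symmOfSym2 f).IsSymm := by
  ext i j
  simp [symmOfSym2, Sym2.eq_swap]

lemma symmOfSym2_injective {k : ℕ} : Function.Injective (symmOfSym2 (k := k)) := by
  intro f g h
  funext z
  induction z with
  | _ i j => exact congrFun (congrFun h i) j

lemma blockMatrix_injective {k : ℕ} {m₁ m₂ m₁' m₂' : Matrix (Fin k) (Fin k) ℝ}
    (h : blockMatrix m₁ m₂ = blockMatrix m₁' m₂') : m₁ = m₁' ∧ m₂ = m₂' := by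
  have h' := Matrix.fromBlocks_inj.mp ((Matrix.reindex _ _).injective h)
  exact ⟨h'.1, h'.2.1⟩

lemma le_finrank_blockSubspace (p : ℕ) :
    p ^ 2 + 3 * p + 2 ≤ Module.finrank ℝ (blockSubspace (p + 1)) := by
  let T : ((Sym2 (Fin (p + 1)) → ℝ) × (Sym2 (Fin (p + 1)) → ℝ)) →ₗ[ℝ] blockSubspace (p + 1) :=
    { toFun := fun f => ⟨blockMatrix (symmOfSym2 f.1) (symmOfSym2 f.2), _, _,
        isSymm_symmOfSym2 _, isSymm_symmOfSym2 _, rfl⟩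
      map_add' := fun f g => by
        ext i j
        simp only [blockMatrix, Matrix.reindex_apply, Matrix.submatrix_apply, Submodule.coe_add,
          Matrix.add_apply]
        rcases (finSumFinEquiv.trans (finCongr (two_mul (p + 1)).symm)).symm i with i | i <;>
        rcases (finSumFinEquiv.trans (finCongr (two_mul (p + 1)).symm)).symm j with j | j <;>
        simp [symmOfSym2, add_comm]
      map_smul' := fun c f => by
        ext i j
        simp only [blockMatrix, Matrix.reindex_apply, Matrix.submatrix_apply, Submodule.coe_smul,
          Matrix.smul_apply]
        rcases (finSumFinEquiv.trans (finCongr (two_mul (p + 1)).symm)).symm i with i | i <;>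
        rcases (finSumFinEquiv.trans (finCongr (two_mul (p + 1)).symm)).symm j with j | j <;>
        simp [symmOfSym2] }
  have hT : Function.Injective T := by
    intro f g h
    obtain ⟨h₁, h₂⟩ := blockMatrix_injective (congrArg Subtype.val h)
    exact Prod.ext (symmOfSym2_injective h₁) (symmOfSym2_injective h₂)
  have h := LinearMap.finrank_le_finrank_of_injective hT
  rw [Module.finrank_prod, Module.finrank_fintype_fun_eq_card, Sym2.card, Fintype.card_fin,
    Nat.choose_two_right, Nat.add_sub_cancel] at h
  have h2 : 2 * ((p + 1 + 1) * (p + 1) / 2) = (p + 1 + 1) * (p + 1) :=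
    Nat.mul_div_cancel' ((Nat.even_mul_pred_self (p + 1 + 1)).two_dvd)
  rw [← two_mul, h2] at h
  linarith

/-- The upper bound is the general one, applicable because the space contains a regular point. -/
lemma finrank_blockSubspace (p : ℕ) :
    Module.finrank ℝ (blockSubspace (p + 1)) = p ^ 2 + 3 * p + 2 :=
  le_antisymm ((isAustereSubspace_blockSubspace (p + 1)).finrank_le_of_even
    (blockSubspace_inter_regularSet_nonempty p)) (le_finrank_blockSubspace p)

/-- A larger austere subspace contains the same regular point, so it obeys the same bound and cannot
have larger dimension. -/
lemma maximal_blockSubspace (p : ℕ) : Maximal IsAustereSubspace (blockSubspace (p + 1)) := by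
  refine ⟨isAustereSubspace_blockSubspace (p + 1), fun Q hQ hle => ?_⟩
  have hdim := hQ.finrank_le_of_even ((blockSubspace_inter_regularSet_nonempty p).mono
    (Set.inter_subset_inter_left _ hle))
  rw [← finrank_blockSubspace] at hdim
  exact (Submodule.eq_of_le_of_finrank_le hle hdim).ge

end Austere

theorem mainTheorem2 :
    (∀ (n : ℕ) (Q : Submodule ℝ (Matrix (Fin n) (Fin n) ℝ)),
      Austere.IsAustereSubspace Q →
      ((Q : Set (Matrix (Fin n) (Fin n) ℝ)) ∩ Austere.regularSet n).Nonempty →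
      ∀ p : ℕ,
        (n = 2 * p + 1 → Module.finrank ℝ Q ≤ p ^ 2 + 2 * p) ∧
        (n = 2 * p + 2 → Module.finrank ℝ Q ≤ p ^ 2 + 3 * p + 2)) ∧
    (∀ p : ℕ,
      Maximal Austere.IsAustereSubspace (Austere.blockSubspace (p + 1)) ∧
      ((Austere.blockSubspace (p + 1) :
          Set (Matrix (Fin (2 * (p + 1))) (Fin (2 * (p + 1))) ℝ)) ∩
        Austere.regularSet (2 * (p + 1))).Nonempty ∧
      Module.finrank ℝ (Austere.blockSubspace (p + 1)) = p ^ 2 + 3 * p + 2) := by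
  refine ⟨fun n Q hQ hreg p => ⟨?_, ?_⟩, fun p => ⟨Austere.maximal_blockSubspace p,
    Austere.blockSubspace_inter_regularSet_nonempty p, Austere.finrank_blockSubspace p⟩⟩
  · rintro rfl
    exact hQ.finrank_le_of_odd hreg
  · rintro rfl
    exact Austere.IsAustereSubspace.finrank_le_of_even hQ hreg
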